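/- Let $I$ be a finite totally ordered set and let $C=(a_{ij})_{i,j\in I}$ be a symmetrizable Cartan matrix of finite type: an integer matrix with $a_{ii}=2$ for all $i$ and $a_{ij}\le 0$ for $i\neq j$, together with positive integers $d_i$ ($i\in I$) such that the matrix $(d_ia_{ij})_{i,j\in I}$ is symmetric and positive definite (for example the minimal such $d_i$). Let $Q=\mathbf{Z}I$ be the root lattice with basis the simple roots $\alpha_i$, $i\in I$; let $R\subset Q$ be the root system of $C$, i.e. the orbit of the simple roots under the group generated by the simple reflections $s_i(\alpha_j)=\alpha_j-a_{ij}\alpha_i$; and let $R^+\subset R$ be the set of positive roots, i.e. the roots with nonnegative coordinates. Let $\langle\,,\rangle$ be the (non-symmetric) bilinear form on $Q$ with $$\langle\alpha_i,\alpha_j\rangle=\begin{cases} d_ia_{ij}, & i<j,\\ d_i, & i=j,\\ 0, & i>j.\end{cases}$$ Then $R^+$ is finite, and there is an enumeration $\alpha^1,\ldots,\alpha^\nu$ of $R^+$ (without repetition) such that $\langle\alpha^k,\alpha^l\rangle\ge 0$ whenever $k\le l$, and $\langle\alpha^k,\alpha^l\rangle\le 0$ whenever $k>l$. In particular, directed partitions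 of $R^+$ exist: there is a partition of $R^+$ into pairwise disjoint nonempty subsets $R^+=\mathcal{I}_1\cup\ldots\cup\mathcal{I}_k$ such that $\langle\alpha,\beta\rangle\ge 0$ for all $\alpha,\beta\in\mathcal{I}_s$, $1\le s\le k$, and $\langle\alpha,\beta\rangle\ge 0\ge\langle\beta,\alpha\rangle$ for all $\alpha\in\mathcal{I}_s$, $\beta\in\mathcal{I}_t$, $1\le s<t\le k$. -/

import Mathlib

/-- `C` is a symmetrizable Cartan matrix of finite type, symmetrized by the positive integers
`d i`: positive definiteness refers to the symmetric matrix `(d i * C i j)`. -/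
structure IsFiniteTypeCartan {I : Type*} [Fintype I] (C : Matrix I I ℤ) (d : I → ℤ) : Prop where
  diag : ∀ i, C i i = 2
  off_diag : ∀ i j, i ≠ j → C i j ≤ 0
  pos : ∀ i, 0 < d i
  symm : ∀ i j, d i * C i j = d j * C j i
  posDef : (Matrix.of fun i j => ((d i * C i j : ℤ) : ℝ)).PosDef

/-- The simple root `α_i` in the root lattice `Q = ℤI`. -/
def simpleRoot {I : Type*} [DecidableEq I] (i : I) : I → ℤ := Pi.single i 1

/-- The simple reflection `s_i(x) = x - (∑ j, a_{ij} x_j) α_i` of the root lattice,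
so that `s_i(α_j) = α_j - a_{ij} α_i`. -/
def simpleReflection {I : Type*} [Fintype I] [DecidableEq I] (C : Matrix I I ℤ) (i : I)
    (x : I → ℤ) : I → ℤ :=
  x - (∑ j, C i j * x j) • simpleRoot i

/-- The root system `R(C)`: the orbit of the simple roots under the Weyl group, which is
generated by the simple reflections, as a subset of the root lattice. -/
inductive IsRoot {I : Type*} [Fintype I] [DecidableEq I] (C : Matrix I I ℤ) : (I → ℤ) → Prop
  | simple (i : I) : IsRoot C (simpleRoot i)
  | reflect (i : I) (x : I → ℤ) : IsRoot C x → IsRoot C (simpleReflection C i x)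

/-- The set `R⁺` of positive roots: roots with nonnegative coordinates. -/
def positiveRoots {I : Type*} [Fintype I] [DecidableEq I] (C : Matrix I I ℤ) : Set (I → ℤ) :=
  {x | IsRoot C x ∧ ∀ i, 0 ≤ x i}

/-- The values `⟨α_i, α_j⟩` of the non-symmetric form on simple roots. -/
def eulerMatrix {I : Type*} [LinearOrder I] (C : Matrix I I ℤ) (d : I → ℤ) : Matrix I I ℤ :=
  Matrix.of fun i j => if i < j then d i * C i j else if i = j then d i else 0

/-- The non-symmetric bilinear form `⟨x, y⟩` on the root lattice. -/
def eulerForm {I : Type*} [Fintype I] [LinearOrder I] (C : Matrix I I ℤ) (d : I → ℤ)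
    (x y : I → ℤ) : ℤ :=
  ∑ i, ∑ j, x i * eulerMatrix C d i j * y j

/-- `P 0, …, P (k - 1)` is a directed partition of the set of positive roots. -/
structure IsDirectedPartition {I : Type*} [Fintype I] [LinearOrder I] (C : Matrix I I ℤ)
    (d : I → ℤ) {k : ℕ} (P : Fin k → Set (I → ℤ)) : Prop where
  nonempty : ∀ s, (P s).Nonempty
  disjoint : ∀ s t, s ≠ t → Disjoint (P s) (P t)
  cover : ⋃ s, P s = positiveRoots C
  within : ∀ s, ∀ x ∈ P s, ∀ y ∈ P s, 0 ≤ eulerForm C d x y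
  between : ∀ s t, s < t → ∀ x ∈ P s, ∀ y ∈ P t,
    0 ≤ eulerForm C d x y ∧ eulerForm C d y x ≤ 0

/-!
# Directed enumerations of the positive roots

Write `E` for the form `eulerForm C d`. It satisfies `2 E(x, x) = (x, x)` for the symmetric form
`(x, y) = ∑ d i * C i j * x i * y j`.

*Positive roots.* Instead of Weyl group lengths, the argument uses the arithmetic property
`IsRootVector`: `E(x, x) = D` is one of the `d i`, and `D ∣ d k * x k` for all `k` (that is, the
coroot of `x` is integral). Simple roots have it and simple reflections preserve it, so all roots
have it. If `x` had coordinates of both signs, `x = x⁺ - x⁻`, then `E(x⁺, x⁺)` and `E(x⁻, x⁻)`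
would be positive multiples of `D` with sum at most `D`, because the off-diagonal entries are
nonpositive; hence a root vector has coordinates of one sign (`IsRootVector.nonneg_or_nonpos`).
Consequently `s_a` permutes the nonnegative root vectors other than `α_a`
(`IsRootVector.reflection_nonneg`). There are only finitely many root vectors, by the
Cauchy-Schwarz inequality (`finite_rootVectors`).

*Enumeration.* Let `a` be the largest index. For a positive root `y ≠ α_a`,
`E(α_a, y) = d a * y a ≥ 0`, and `E(y, α_a) = - d a * (s_a y) a ≤ 0`, so `α_a` may come first. The
reflection `s_a` maps the remaining positive roots to positive roots and `E` to the form of the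
same kind for the order in which `a` has become the smallest index (`orderForm_rotate`). The
enumeration is continued with that order, and transported back by `s_a` (`exists_directed_list`).

*Termination.* Each round through all indices applies a Coxeter element `c`. If a root stayed
positive forever, its `c`-orbit would run into a cycle of positive vectors, whose sum is a nonzero
fixed vector of `c`. But a fixed vector of `c` is fixed by every simple reflection
(`reflection_eq_of_coxeterMap_eq`), so it is orthogonal to everything, so it vanishes.
-/

/-! ### Simple reflections and Coxeter elements -/

section SimpleReflections

variable {I : Type*} [Fintype I] [DecidableEq I]

theorem simpleReflection_apply_self (C : Matrix I I ℤ) (i : I) (x : I → ℤ) :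
    simpleReflection C i x i = x i - ∑ j, C i j * x j := by
  simp [simpleReflection, simpleRoot]

theorem simpleReflection_apply_of_ne (C : Matrix I I ℤ) {i k : I} (h : k ≠ i) (x : I → ℤ) :
    simpleReflection C i x k = x k := by
  simp [simpleReflection, simpleRoot, h]

/-- The simple reflection as an endomorphism of the root lattice. -/
def simpleReflectionHom (C : Matrix I I ℤ) (i : I) : (I → ℤ) →+ (I → ℤ) where
  toFun := simpleReflection C i
  map_zero' := by simp [simpleReflection]
  map_add' x y := by
    simp only [simpleReflection, Pi.add_apply, mul_add, Finset.sum_add_distrib, add_smul]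
    abel

theorem simpleReflection_involutive {C : Matrix I I ℤ} {i : I} (h : C i i = 2) (x : I → ℤ) :
    simpleReflection C i (simpleReflection C i x) = x := by
  have key : ∑ j, C i j * simpleReflection C i x j = - ∑ j, C i j * x j := by
    simp only [simpleReflection, Pi.sub_apply, Pi.smul_apply, smul_eq_mul, mul_sub,
      Finset.sum_sub_distrib]
    have : ∑ j, C i j * ((∑ k, C i k * x k) * simpleRoot i j) = 2 * ∑ k, C i k * x k := by
      rw [Finset.sum_eq_single i]
      · simp [simpleRoot, h]
      · intro j _ hj
        simp [simpleRoot, hj]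
      · simp
    rw [this]
    ring
  rw [simpleReflection, key, simpleReflection]
  simp

/-- The product of the simple reflections along a list, the head being applied first. For a list
of all the indices this is a Coxeter element. -/
def coxeterMap (C : Matrix I I ℤ) : List I → ((I → ℤ) →+ (I → ℤ))
  | [] => AddMonoidHom.id _
  | a :: t => (coxeterMap C t).comp (simpleReflectionHom C a)

theorem coxeterMap_cons (C : Matrix I I ℤ) (a : I) (t : List I) (x : I → ℤ) :
    coxeterMap C (a :: t) x = coxeterMap C t (simpleReflection C a x) := rfl

theorem coxeterMap_apply_of_notMem (C : Matrix I I ℤ) {l : List I} {k : I} (h : k ∉ l)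
    (x : I → ℤ) : coxeterMap C l x k = x k := by
  induction l generalizing x with
  | nil => rfl
  | cons a t ih =>
    rw [List.mem_cons, not_or] at h
    rw [coxeterMap_cons, ih h.2, simpleReflection_apply_of_ne C h.1]

/-- A product of distinct simple reflections fixes only the vectors fixed by each factor: the
`a`-th coordinate is changed by the factor `s_a` only. -/
theorem reflection_eq_of_coxeterMap_eq (C : Matrix I I ℤ) {l : List I} (hl : l.Nodup) {x : I → ℤ}
    (h : coxeterMap C l x = x) : ∀ a ∈ l, simpleReflection C a x = x := by
  induction l with
  | nil => simp
  | cons a t ih =>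
    rw [List.nodup_cons] at hl
    rw [coxeterMap_cons] at h
    have ha : simpleReflection C a x = x := by
      ext k
      by_cases hk : k = a
      · subst hk
        rw [← coxeterMap_apply_of_notMem C hl.1 (simpleReflection C k x), h]
      · exact simpleReflection_apply_of_ne C hk x
    rw [ha] at h
    simpa [ha] using ih hl.2 h

/-- The image of `x` after `k` steps, where each step reflects in the head of the list and then
moves the head to the end. -/
def trajectory (C : Matrix I I ℤ) : List I → ℕ → (I → ℤ) → (I → ℤ)
  | _, 0, x => x
  | [], _ + 1, x => x
  | a :: t, k + 1, x => trajectory C (t ++ [a]) k (simpleReflection C a x)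

theorem trajectory_append (C : Matrix I I ℤ) (l₁ l₂ : List I) (k : ℕ) (x : I → ℤ) :
    trajectory C (l₁ ++ l₂) (l₁.length + k) x = trajectory C (l₂ ++ l₁) k (coxeterMap C l₁ x) := by
  induction l₁ generalizing l₂ x with
  | nil => simp [coxeterMap]
  | cons a t ih =>
    rw [List.length_cons, Nat.add_right_comm, List.cons_append, trajectory, List.append_assoc, ih,
      coxeterMap_cons, List.append_assoc, List.singleton_append]

theorem trajectory_mul_length (C : Matrix I I ℤ) (l : List I) (m : ℕ) (x : I → ℤ) :
    trajectory C l (m * l.length) x = (coxeterMap C l)^[m] x := by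
  induction m generalizing x with
  | zero => simp [trajectory]
  | succ m ih =>
    have := trajectory_append C l [] (m * l.length) x
    rw [List.append_nil, List.nil_append, ih] at this
    rw [Nat.succ_mul, Nat.add_comm, this, Function.iterate_succ_apply]

end SimpleReflections

/-! ### The non-symmetric form of an ordered list of indices -/

section OrderForm

variable {I : Type*}

/-- The form `⟨x, y⟩` of the order on the entries of a list in which they are listed
**decreasingly**: `⟨α_a, α_j⟩ = 0` and `⟨α_j, α_a⟩ = d a * C a j` whenever `a` precedes `j`. -/
def orderForm (C : Matrix I I ℤ) (d : I → ℤ) : List I → (I → ℤ) → (I → ℤ) → ℤ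
  | [], _, _ => 0
  | a :: t, x, y => d a * (x a + (t.map fun j => C a j * x j).sum) * y a + orderForm C d t x y

theorem orderForm_congr (C : Matrix I I ℤ) (d : I → ℤ) {l : List I} {x x' y y' : I → ℤ}
    (hx : ∀ i ∈ l, x i = x' i) (hy : ∀ i ∈ l, y i = y' i) :
    orderForm C d l x y = orderForm C d l x' y' := by
  induction l with
  | nil => rfl
  | cons a t ih =>
    simp only [List.forall_mem_cons] at hx hy
    have : (t.map fun j => C a j * x j) = t.map fun j => C a j * x' j :=
      List.map_congr_left fun j hj => by rw [hx.2 j hj]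
    rw [orderForm, orderForm, ih hx.2 hy.2, hx.1, hy.1, this]

theorem orderForm_zero_left (C : Matrix I I ℤ) (d : I → ℤ) (l : List I) (y : I → ℤ) :
    orderForm C d l 0 y = 0 := by
  induction l with
  | nil => rfl
  | cons a t ih => simp [orderForm, ih]

theorem orderForm_zero_right (C : Matrix I I ℤ) (d : I → ℤ) (l : List I) (x : I → ℤ) :
    orderForm C d l x 0 = 0 := by
  induction l with
  | nil => rfl
  | cons a t ih => simp [orderForm, ih]

theorem orderForm_append_singleton {C : Matrix I I ℤ} {d : I → ℤ}
    (hs : ∀ i j, d i * C i j = d j * C j i) (t : List I) (a : I) (x y : I → ℤ) :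
    orderForm C d (t ++ [a]) x y =
      orderForm C d t x y + d a * x a * (y a + (t.map fun j => C a j * y j).sum) := by
  induction t with
  | nil => simp [orderForm]
  | cons b t ih =>
    simp only [List.cons_append, orderForm, ih, List.map_append, List.sum_append, List.map_cons,
      List.map_nil, List.sum_cons, List.sum_nil]
    linear_combination x a * y b * hs b a

theorem orderForm_simpleRoot_left [DecidableEq I] (C : Matrix I I ℤ) (d : I → ℤ) {a : I}
    {t : List I} (ha : a ∉ t) (y : I → ℤ) : orderForm C d (a :: t) (simpleRoot a) y = d a * y a := by
  have h0 : ∀ i ∈ t, simpleRoot a i = (0 : I → ℤ) i := fun i hi => by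
    simp [simpleRoot, ne_of_mem_of_not_mem hi ha]
  have h1 : (t.map fun j => C a j * simpleRoot a j) = t.map fun _ => (0 : ℤ) :=
    List.map_congr_left fun j hj => by simp [h0 j hj]
  rw [orderForm, orderForm_congr C d h0 fun _ _ => rfl, orderForm_zero_left, h1]
  simp [simpleRoot]

section Rotate

variable [Fintype I] [DecidableEq I]

theorem simpleReflection_apply_head {C : Matrix I I ℤ} {a : I} {t : List I} (h2 : C a a = 2)
    (hl : (a :: t).Nodup) (hmem : ∀ i, i ∈ a :: t) (x : I → ℤ) :
    simpleReflection C a x a = -(x a + (t.map fun j => C a j * x j).sum) := by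
  have h : ∑ j, C a j * x j = ((a :: t).map fun j => C a j * x j).sum := by
    rw [← List.sum_toFinset _ hl]
    congr 1
    ext i
    simpa using hmem i
  rw [simpleReflection_apply_self, h, List.map_cons, List.sum_cons, h2]
  ring

theorem orderForm_reflection_of_notMem (C : Matrix I I ℤ) (d : I → ℤ) {a : I} {t : List I}
    (ha : a ∉ t) (x y : I → ℤ) :
    orderForm C d t (simpleReflection C a x) (simpleReflection C a y) = orderForm C d t x y :=
  orderForm_congr C d
    (fun _ hi => simpleReflection_apply_of_ne C (ne_of_mem_of_not_mem hi ha) x)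
    (fun _ hi => simpleReflection_apply_of_ne C (ne_of_mem_of_not_mem hi ha) y)

/-- The reflection in the largest index `a` transports the form to the one of the order in which
`a` has become the smallest index. -/
theorem orderForm_rotate {C : Matrix I I ℤ} {d : I → ℤ} {a : I} {t : List I} (h2 : C a a = 2)
    (hs : ∀ i j, d i * C i j = d j * C j i) (hl : (a :: t).Nodup) (hmem : ∀ i, i ∈ a :: t)
    (x y : I → ℤ) :
    orderForm C d (t ++ [a]) (simpleReflection C a x) (simpleReflection C a y) =
      orderForm C d (a :: t) x y := by
  have ha : a ∉ t := (List.nodup_cons.1 hl).1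
  have hy : (t.map fun j => C a j * simpleReflection C a y j) = t.map fun j => C a j * y j :=
    List.map_congr_left fun j hj => by
      rw [simpleReflection_apply_of_ne C (ne_of_mem_of_not_mem hj ha)]
  rw [orderForm_append_singleton hs, orderForm_reflection_of_notMem C d ha, hy,
    simpleReflection_apply_head h2 hl hmem, simpleReflection_apply_head h2 hl hmem, orderForm]
  ring

theorem orderForm_simpleRoot_right {C : Matrix I I ℤ} (d : I → ℤ) {a : I} {t : List I}
    (h2 : C a a = 2) (hl : (a :: t).Nodup) (hmem : ∀ i, i ∈ a :: t) (x : I → ℤ) :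
    orderForm C d (a :: t) x (simpleRoot a) = -(d a * simpleReflection C a x a) := by
  have ha : a ∉ t := (List.nodup_cons.1 hl).1
  have h0 : ∀ i ∈ t, simpleRoot a i = (0 : I → ℤ) i := fun i hi => by
    simp [simpleRoot, ne_of_mem_of_not_mem hi ha]
  rw [orderForm, orderForm_congr C d (fun _ _ => rfl) h0, orderForm_zero_right,
    simpleReflection_apply_head h2 hl hmem]
  simp only [simpleRoot, Pi.single_eq_same]
  ring

end Rotate

theorem eulerMatrix_self [LinearOrder I] (C : Matrix I I ℤ) (d : I → ℤ) (i : I) :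
    eulerMatrix C d i i = d i := by
  simp [eulerMatrix]

theorem eulerMatrix_of_lt [LinearOrder I] (C : Matrix I I ℤ) (d : I → ℤ) {i j : I} (h : i < j) :
    eulerMatrix C d i j = d i * C i j := by
  simp [eulerMatrix, h]

theorem eulerMatrix_of_gt [LinearOrder I] (C : Matrix I I ℤ) (d : I → ℤ) {i j : I} (h : j < i) :
    eulerMatrix C d i j = 0 := by
  simp [eulerMatrix, h.not_gt, h.ne']

theorem orderForm_eq_sum [LinearOrder I] {C : Matrix I I ℤ} {d : I → ℤ}
    (hs : ∀ i j, d i * C i j = d j * C j i) {l : List I} (hl : l.Pairwise (· > ·))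
    (x y : I → ℤ) :
    orderForm C d l x y =
      (l.map fun j => (l.map fun i => x i * eulerMatrix C d i j * y j).sum).sum := by
  induction l with
  | nil => rfl
  | cons a t ih =>
    rw [List.pairwise_cons] at hl
    have h1 : (t.map fun i => x i * eulerMatrix C d i a * y a) =
        t.map fun i => d a * y a * (C a i * x i) :=
      List.map_congr_left fun i hi => by
        rw [eulerMatrix_of_lt C d (hl.1 i hi), hs i a]
        ring
    have h2 : (t.map fun j => ((a :: t).map fun i => x i * eulerMatrix C d i j * y j).sum) =
        t.map fun j => (t.map fun i => x i * eulerMatrix C d i j * y j).sum :=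
      List.map_congr_left fun j hj => by
        rw [List.map_cons, List.sum_cons, eulerMatrix_of_gt C d (hl.1 j hj)]
        ring
    rw [List.map_cons, List.sum_cons, h2, ← ih hl.2, List.map_cons, List.sum_cons, h1,
      List.sum_map_mul_left, eulerMatrix_self, orderForm]
    ring

theorem orderForm_eq_eulerForm [Fintype I] [LinearOrder I] {C : Matrix I I ℤ} {d : I → ℤ}
    (hs : ∀ i j, d i * C i j = d j * C j i) {l : List I} (hl : l.Pairwise (· > ·))
    (hmem : ∀ i, i ∈ l) (x y : I → ℤ) : orderForm C d l x y = eulerForm C d x y := by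
  have hn : l.Nodup := hl.imp fun h => h.ne'
  have hu : l.toFinset = Finset.univ := by
    ext i
    simpa using hmem i
  rw [orderForm_eq_sum hs hl, eulerForm, Finset.sum_comm, ← List.sum_toFinset _ hn, hu]
  refine Finset.sum_congr rfl fun j _ => ?_
  rw [← List.sum_toFinset _ hn, hu]

end OrderForm

/-! ### Root vectors -/

section RootVectors

variable {I : Type*} [Fintype I] [LinearOrder I] {C : Matrix I I ℤ} {d : I → ℤ}

/-- The symmetric form `(x, y) = ∑ x i * (d i * C i j) * y j` on the root lattice. -/
abbrev symForm (C : Matrix I I ℤ) (d : I → ℤ) : LinearMap.BilinForm ℤ (I → ℤ) :=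
  Matrix.toBilin' (Matrix.of fun i j => d i * C i j)

theorem symForm_apply (C : Matrix I I ℤ) (d x y : I → ℤ) :
    symForm C d x y = ∑ i, ∑ j, x i * (d i * C i j) * y j := by
  rw [symForm, Matrix.toBilin'_apply]
  rfl

theorem symForm_eq_sum (C : Matrix I I ℤ) (d x y : I → ℤ) :
    symForm C d x y = ∑ i, x i * d i * ∑ j, C i j * y j := by
  rw [symForm_apply]
  simp only [Finset.mul_sum]
  exact Finset.sum_congr rfl fun i _ => Finset.sum_congr rfl fun j _ => by ring

theorem symForm_simpleRoot_left (C : Matrix I I ℤ) (d : I → ℤ) (i : I) (y : I → ℤ) :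
    symForm C d (simpleRoot i) y = d i * ∑ j, C i j * y j := by
  rw [symForm_eq_sum, Finset.sum_eq_single i]
  · simp [simpleRoot]
  · intro j _ hj
    simp [simpleRoot, hj]
  · simp

theorem symForm_simpleRoot_self (hC : IsFiniteTypeCartan C d) (i : I) :
    symForm C d (simpleRoot i) (simpleRoot i) = 2 * d i := by
  rw [symForm_simpleRoot_left, Finset.sum_eq_single i
    (fun j _ hj => by simp [simpleRoot, hj]) (by simp), hC.diag]
  simp [simpleRoot, mul_comm]

theorem symForm_comm (hC : IsFiniteTypeCartan C d) (x y : I → ℤ) :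
    symForm C d x y = symForm C d y x := by
  rw [symForm_apply, symForm_apply, Finset.sum_comm]
  refine Finset.sum_congr rfl fun j _ => Finset.sum_congr rfl fun i _ => ?_
  rw [hC.symm i j]
  ring

theorem symForm_self_pos (hC : IsFiniteTypeCartan C d) {x : I → ℤ} (hx : x ≠ 0) :
    0 < symForm C d x x := by
  have h0 : (fun i => (x i : ℝ)) ≠ 0 := fun h => hx <| by
    ext i
    simpa using congrFun h i
  have h := hC.posDef.dotProduct_mulVec_pos h0
  have he : (star (fun i => (x i : ℝ)) ⬝ᵥ
      (Matrix.of fun i j => ((d i * C i j : ℤ) : ℝ)).mulVec fun i => (x i : ℝ)) =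
      ((symForm C d x x : ℤ) : ℝ) := by
    rw [symForm_apply]
    simp only [dotProduct, Matrix.mulVec, Finset.mul_sum, Matrix.of_apply]
    push_cast
    exact Finset.sum_congr rfl fun i _ => Finset.sum_congr rfl fun j _ => by simp [mul_assoc]
  rw [he] at h
  exact_mod_cast h

theorem symForm_self_eq_two_mul (hC : IsFiniteTypeCartan C d) (x : I → ℤ) :
    symForm C d x x = 2 * eulerForm C d x x := by
  have h : eulerForm C d x x = ∑ i, ∑ j, x i * eulerMatrix C d j i * x j := by
    rw [eulerForm, Finset.sum_comm]
    exact Finset.sum_congr rfl fun i _ => Finset.sum_congr rfl fun j _ => by ring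
  rw [two_mul]
  nth_rewrite 2 [h]
  rw [symForm_apply, eulerForm, ← Finset.sum_add_distrib]
  refine Finset.sum_congr rfl fun i _ => ?_
  rw [← Finset.sum_add_distrib]
  refine Finset.sum_congr rfl fun j _ => ?_
  have hM : d i * C i j = eulerMatrix C d i j + eulerMatrix C d j i := by
    rcases lt_trichotomy i j with h | rfl | h
    · rw [eulerMatrix_of_lt C d h, eulerMatrix_of_gt C d h, add_zero]
    · rw [eulerMatrix_self, hC.diag]
      ring
    · rw [eulerMatrix_of_lt C d h, eulerMatrix_of_gt C d h, zero_add, hC.symm]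
  rw [hM]
  ring

theorem eulerForm_self_pos (hC : IsFiniteTypeCartan C d) {x : I → ℤ} (hx : x ≠ 0) :
    0 < eulerForm C d x x := by
  have := symForm_self_pos hC hx
  rw [symForm_self_eq_two_mul hC] at this
  omega

theorem dvd_eulerForm {D : ℤ} {x : I → ℤ} (h : ∀ k, D ∣ d k * x k) (y : I → ℤ) :
    D ∣ eulerForm C d x y := by
  refine Finset.dvd_sum fun i _ => Finset.dvd_sum fun j _ => ?_
  refine Dvd.dvd.mul_right ?_ _
  rcases lt_trichotomy i j with hij | rfl | hij
  · rw [eulerMatrix_of_lt C d hij]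
    convert (h i).mul_right (C i j) using 1
    ring
  · rw [eulerMatrix_self, mul_comm]
    exact h i
  · simp [eulerMatrix_of_gt C d hij]

/-- A root vector `x` is a lattice vector of the same norm as some simple root, say
`⟨x, x⟩ = D = d i`, that is `(x, x) = 2 * D`, such that `D` divides every `d k * x k`. The latter says that the
coroot `2 x / (x, x)` is an integral combination of the simple coroots `α_k / d k`. -/
def IsRootVector (C : Matrix I I ℤ) (d x : I → ℤ) : Prop :=
  (∃ i, eulerForm C d x x = d i) ∧ ∀ k, eulerForm C d x x ∣ d k * x k

theorem IsRootVector.norm_pos (hC : IsFiniteTypeCartan C d) {x : I → ℤ}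
    (hx : IsRootVector C d x) : 0 < eulerForm C d x x := by
  obtain ⟨⟨i, hi⟩, -⟩ := hx
  rw [hi]
  exact hC.pos i

theorem IsRootVector.ne_zero (hC : IsFiniteTypeCartan C d) {x : I → ℤ}
    (hx : IsRootVector C d x) : x ≠ 0 := by
  rintro rfl
  simpa [eulerForm] using hx.norm_pos hC

theorem isRootVector_simpleRoot (hC : IsFiniteTypeCartan C d) (i : I) :
    IsRootVector C d (simpleRoot i) := by
  have h : eulerForm C d (simpleRoot i) (simpleRoot i) = d i := by
    have h2 := symForm_self_eq_two_mul hC (simpleRoot i)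
    rw [symForm_simpleRoot_self hC] at h2
    omega
  rw [IsRootVector, h]
  refine ⟨⟨i, rfl⟩, fun k => ?_⟩
  by_cases hk : k = i
  · rw [hk]
    exact dvd_mul_right _ _
  · simp [simpleRoot, hk]

theorem eulerForm_reflection_self (hC : IsFiniteTypeCartan C d) (i : I) (x : I → ℤ) :
    eulerForm C d (simpleReflection C i x) (simpleReflection C i x) = eulerForm C d x x := by
  have h : symForm C d (simpleReflection C i x) (simpleReflection C i x) = symForm C d x x := by
    have h1 := symForm_simpleRoot_left C d i x
    simp only [simpleReflection, map_sub, map_smul, LinearMap.sub_apply, LinearMap.smul_apply,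
      smul_eq_mul]
    rw [symForm_comm hC x (simpleRoot i), h1, symForm_simpleRoot_self hC]
    ring
  rw [symForm_self_eq_two_mul hC, symForm_self_eq_two_mul hC] at h
  omega

theorem IsRootVector.reflection (hC : IsFiniteTypeCartan C d) {x : I → ℤ}
    (hx : IsRootVector C d x) (i : I) : IsRootVector C d (simpleReflection C i x) := by
  rw [IsRootVector, eulerForm_reflection_self hC]
  refine ⟨hx.1, fun k => ?_⟩
  by_cases hk : k = i
  · subst hk
    rw [simpleReflection_apply_self, mul_sub, Finset.mul_sum]
    refine dvd_sub (hx.2 k) (Finset.dvd_sum fun j _ => ?_)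
    rw [← mul_assoc, hC.symm, mul_right_comm]
    exact (hx.2 j).mul_right _
  · rw [simpleReflection_apply_of_ne C hk]
    exact hx.2 k

theorem IsRoot.isRootVector (hC : IsFiniteTypeCartan C d) {x : I → ℤ} (hx : IsRoot C x) :
    IsRootVector C d x := by
  induction hx with
  | simple i => exact isRootVector_simpleRoot hC i
  | reflect i x _ ih => exact ih.reflection hC i

/-- The coordinates of a root vector all have the same sign: otherwise its positive and negative
parts would both have at least its norm, and they form an obtuse angle. -/
theorem IsRootVector.nonneg_or_nonpos (hC : IsFiniteTypeCartan C d) {x : I → ℤ}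
    (hx : IsRootVector C d x) : (∀ k, 0 ≤ x k) ∨ ∀ k, x k ≤ 0 := by
  by_contra! hcon
  obtain ⟨⟨j, hj⟩, ⟨k, hk⟩⟩ := hcon
  have hD := hx.norm_pos hC
  have hdvd := hx.2
  set D := eulerForm C d x x with hDdef
  set p : I → ℤ := fun i => max (x i) 0 with hp
  set m : I → ℤ := fun i => max (-x i) 0 with hm
  have hxpm : x = p - m := by
    ext i
    simp only [hp, hm, Pi.sub_apply]
    omega
  have hp0 : p ≠ 0 := fun h => by
    have := congrFun h k
    simp only [hp, Pi.zero_apply] at this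
    omega
  have hm0 : m ≠ 0 := fun h => by
    have := congrFun h j
    simp only [hm, Pi.zero_apply] at this
    omega
  have hpd : ∀ i, D ∣ d i * p i := fun i => by
    rcases le_total 0 (x i) with h | h
    · simpa [hp, h] using hdvd i
    · simp [hp, h]
  have hmd : ∀ i, D ∣ d i * m i := fun i => by
    rcases le_total 0 (x i) with h | h
    · simp [hm, h]
    · simpa [hm, h] using hdvd i
  have hP := Int.le_of_dvd (eulerForm_self_pos hC hp0) (dvd_eulerForm (C := C) hpd p)
  have hM := Int.le_of_dvd (eulerForm_self_pos hC hm0) (dvd_eulerForm (C := C) hmd m)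
  have hpm : symForm C d p m ≤ 0 := by
    rw [symForm_apply]
    refine Finset.sum_nonpos fun i _ => Finset.sum_nonpos fun l _ => ?_
    by_cases hil : i = l
    · subst hil
      rcases le_total 0 (x i) with h | h
      · simp [hm, h]
      · simp [hp, h]
    · have h1 : d i * C i l ≤ 0 :=
        mul_nonpos_of_nonneg_of_nonpos (hC.pos i).le (hC.off_diag i l hil)
      exact mul_nonpos_of_nonpos_of_nonneg
        (mul_nonpos_of_nonneg_of_nonpos (le_max_right _ _) h1) (le_max_right _ _)
  have hsum : symForm C d x x = symForm C d p p - 2 * symForm C d p m + symForm C d m m := by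
    rw [hxpm]
    simp only [map_sub, LinearMap.sub_apply]
    rw [symForm_comm hC m p]
    ring
  rw [symForm_self_eq_two_mul hC, symForm_self_eq_two_mul hC, symForm_self_eq_two_mul hC] at hsum
  omega

/-- Root vectors form a reduced system: `α_a` is the only nonnegative multiple of `α_a` that is a
root vector. -/
theorem IsRootVector.eq_simpleRoot (hC : IsFiniteTypeCartan C d) {x : I → ℤ}
    (hx : IsRootVector C d x) {a : I} (ha : 0 ≤ x a) (h : ∀ k, k ≠ a → x k = 0) :
    x = simpleRoot a := by
  have hxa : x = x a • simpleRoot a := by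
    ext k
    by_cases hk : k = a
    · simp [hk, simpleRoot]
    · simp [h k hk, simpleRoot, hk]
  have hE : eulerForm C d x x = d a * x a * x a := by
    rw [eulerForm, Finset.sum_eq_single a (fun i _ hi => by simp [h i hi]) (by simp),
      Finset.sum_eq_single a (fun i _ hi => by simp [h i hi]) (by simp), eulerMatrix_self]
    ring
  have hpos := hx.norm_pos hC
  have hdvd := hx.2 a
  rw [hE] at hpos hdvd
  have h0 : d a * x a ≠ 0 := fun h0 => by simp [h0] at hpos
  have h1 : x a ∣ 1 := by
    rw [← mul_dvd_mul_iff_left h0, mul_one]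
    exact hdvd
  rw [Int.eq_one_of_dvd_one ha h1, one_smul] at hxa
  exact hxa

theorem IsRootVector.reflection_nonneg (hC : IsFiniteTypeCartan C d) {x : I → ℤ}
    (hx : IsRootVector C d x) (h0 : ∀ k, 0 ≤ x k) {a : I} (hne : x ≠ simpleRoot a) (k : I) :
    0 ≤ simpleReflection C a x k := by
  refine ((hx.reflection hC a).nonneg_or_nonpos hC).resolve_right (fun h => hne ?_) k
  refine hx.eq_simpleRoot hC (h0 a) fun k hk => le_antisymm ?_ (h0 k)
  rw [← simpleReflection_apply_of_ne C hk x]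
  exact h k

theorem symForm_sq_le (hC : IsFiniteTypeCartan C d) (i : I) (x : I → ℤ) :
    symForm C d (simpleRoot i) x ^ 2 ≤
      symForm C d (simpleRoot i) (simpleRoot i) * symForm C d x x := by
  have hpos : 0 < symForm C d (simpleRoot i) (simpleRoot i) :=
    symForm_self_pos hC ((isRootVector_simpleRoot hC i).ne_zero hC)
  set q := symForm C d (simpleRoot i) (simpleRoot i)
  set b := symForm C d (simpleRoot i) x with hb
  have h : 0 ≤ symForm C d (q • x - b • simpleRoot i) (q • x - b • simpleRoot i) := by
    by_cases h0 : q • x - b • simpleRoot i = 0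
    · rw [h0]
      simp
    · exact (symForm_self_pos hC h0).le
  have h' : symForm C d (q • x - b • simpleRoot i) (q • x - b • simpleRoot i) =
      q * (q * symForm C d x x - b ^ 2) := by
    simp only [map_sub, map_smul, LinearMap.sub_apply, LinearMap.smul_apply, smul_eq_mul]
    rw [symForm_comm hC x (simpleRoot i), ← hb]
    ring
  rw [h'] at h
  have := nonneg_of_mul_nonneg_right h hpos
  omega

theorem eq_zero_of_pairing_eq_zero (hC : IsFiniteTypeCartan C d) {x : I → ℤ}
    (h : ∀ i, ∑ j, C i j * x j = 0) : x = 0 := by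
  by_contra hx
  have := symForm_self_pos hC hx
  simp [symForm_eq_sum, h] at this

/-- There are finitely many root vectors: their products with the simple roots are bounded, and
these products determine them. -/
theorem finite_rootVectors (hC : IsFiniteTypeCartan C d) : {x | IsRootVector C d x}.Finite := by
  set M := ∑ j, d j
  have hM : ∀ j, d j ≤ M := fun j =>
    Finset.single_le_sum (f := d) (fun i _ => (hC.pos i).le) (Finset.mem_univ j)
  have hfin : (Set.Icc (fun _ : I => -(4 * M)) fun _ => 4 * M).Finite := Set.finite_Icc _ _
  let f : (I → ℤ) →+ (I → ℤ) := (Matrix.mulVecLin C).toAddMonoidHom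
  have hf : ∀ x i, f x i = ∑ j, C i j * x j := fun x i => rfl
  have hinj : Function.Injective f := (injective_iff_map_eq_zero f).2 fun x hx =>
    eq_zero_of_pairing_eq_zero hC fun i => by rw [← hf, hx, Pi.zero_apply]
  refine (hfin.preimage hinj.injOn).subset fun x hx => ?_
  have hb : ∀ i, (f x i) ^ 2 ≤ 4 * M := fun i => by
    have h := symForm_sq_le hC i x
    obtain ⟨⟨k, hk⟩, -⟩ := hx
    rw [symForm_self_eq_two_mul hC x, hk, symForm_simpleRoot_self hC, symForm_simpleRoot_left,
      ← hf] at h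
    have hi := hC.pos i
    have h' : d i * (d i * f x i ^ 2) ≤ d i * (4 * d k) := by linarith
    have h'' := le_of_mul_le_mul_left h' hi
    have : f x i ^ 2 ≤ d i * f x i ^ 2 := le_mul_of_one_le_left (sq_nonneg _) hi
    linarith [hM k]
  -- An integer is bounded by its square.
  have hle : ∀ z : ℤ, z ≤ z ^ 2 := fun z => Int.le_self_sq z
  refine ⟨fun i => ?_, fun i => (hle _).trans (hb i)⟩
  have h := (hle (-f x i)).trans (by simpa using hb i)
  linarith

end RootVectors

/-! ### Termination and enumeration -/

section Enumeration

variable {I : Type*} [Fintype I] [LinearOrder I] {C : Matrix I I ℤ} {d : I → ℤ}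

/-- No positive root stays nonnegative forever: otherwise the sum over a cycle of its orbit under
the Coxeter element would be a nonzero vector fixed by all simple reflections. -/
theorem IsRootVector.exists_trajectory_neg (hC : IsFiniteTypeCartan C d) {l : List I}
    (hl : l.Nodup) (hmem : ∀ i, i ∈ l) {x : I → ℤ} (hx : IsRootVector C d x) :
    ∃ k, ¬ ∀ i, 0 ≤ trajectory C l k x i := by
  by_contra! hcon
  set c := coxeterMap C l with hc
  have hroot : ∀ m, IsRootVector C d (c^[m] x) := fun m => by
    have hstep : ∀ (l' : List I) (y : I → ℤ), IsRootVector C d y →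
        IsRootVector C d (coxeterMap C l' y) := fun l' => by
      induction l' with
      | nil => exact fun y hy => hy
      | cons a t ih => exact fun y hy => ih _ (hy.reflection hC a)
    induction m with
    | zero => exact hx
    | succ m ih =>
      rw [Function.iterate_succ_apply']
      exact hstep l _ ih
  have hnonneg : ∀ m i, 0 ≤ (c^[m] x) i := fun m i => by
    rw [hc, ← trajectory_mul_length]
    exact hcon _ i
  obtain ⟨m, n, hmn, heq⟩ :=
    (finite_rootVectors hC).exists_lt_map_eq_of_forall_mem (f := fun m : ℕ => c^[m] x) hroot
  set S := ∑ k ∈ Finset.Ico m n, c^[k] x with hS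
  have hfix : c S = S := by
    have h := Finset.sum_Ico_sub (fun k => c^[k] x) hmn.le
    rw [← heq, sub_self, Finset.sum_sub_distrib, sub_eq_zero] at h
    rw [hS, map_sum, ← h]
    exact Finset.sum_congr rfl fun k _ => (Function.iterate_succ_apply' c k x).symm
  have hS0 : S = 0 := eq_zero_of_pairing_eq_zero hC fun i => by
    have h := congrFun (reflection_eq_of_coxeterMap_eq C hl hfix i (hmem i)) i
    rw [simpleReflection_apply_self] at h
    omega
  refine (hroot m).ne_zero hC (funext fun i => le_antisymm ?_ (hnonneg m i))
  have h := congrFun hS0 i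
  rw [hS, Finset.sum_apply] at h
  exact (Finset.single_le_sum (f := fun k => (c^[k] x) i) (fun k _ => hnonneg k i)
    (Finset.mem_Ico.2 ⟨le_rfl, hmn⟩)).trans h.le

/-- A finite set of nonnegative root vectors, each of which leaves the nonnegative cone within `N`
reflections, can be listed in a directed way for the order given by `l`. -/
theorem exists_directed_list (hC : IsFiniteTypeCartan C d) (N : ℕ) (l : List I) (hl : l.Nodup)
    (hmem : ∀ i, i ∈ l) (S : Finset (I → ℤ))
    (hS : ∀ x ∈ S, IsRootVector C d x ∧ ∀ i, 0 ≤ x i)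
    (hN : ∀ x ∈ S, ∃ k ≤ N, ¬ ∀ i, 0 ≤ trajectory C l k x i) :
    ∃ L : List (I → ℤ), L.Nodup ∧ (∀ x, x ∈ L ↔ x ∈ S) ∧
      L.Pairwise fun x y => 0 ≤ orderForm C d l x y ∧ orderForm C d l y x ≤ 0 := by
  induction N generalizing l S with
  | zero =>
    refine ⟨[], List.nodup_nil, fun x => ⟨by simp, fun hx => ?_⟩, List.Pairwise.nil⟩
    obtain ⟨k, hk, hneg⟩ := hN x hx
    rw [Nat.le_zero.1 hk, trajectory] at hneg
    exact absurd (hS x hx).2 hneg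
  | succ N ih =>
    cases l with
    | nil =>
      -- There are no indices, hence no root vectors.
      refine ⟨[], List.nodup_nil, fun x => ⟨by simp, fun hx => ?_⟩, List.Pairwise.nil⟩
      exact absurd (funext fun i => by simpa using hmem i) ((hS x hx).1.ne_zero hC)
    | cons a t =>
      set σ := simpleReflection C a with hσ
      have hinv : ∀ x, σ (σ x) = x := simpleReflection_involutive (hC.diag a)
      have hperm : (t ++ [a]).Perm (a :: t) := List.perm_append_singleton a t
      obtain ⟨L, hLn, hLm, hLp⟩ := ih (t ++ [a]) (hperm.nodup_iff.2 hl)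
        (fun i => hperm.mem_iff.2 (hmem i)) ((S.erase (simpleRoot a)).image σ)
        (fun x hx => by
          obtain ⟨y, hy, rfl⟩ := Finset.mem_image.1 hx
          obtain ⟨hne, hyS⟩ := Finset.mem_erase.1 hy
          exact ⟨(hS y hyS).1.reflection hC a,
            (hS y hyS).1.reflection_nonneg hC (hS y hyS).2 hne⟩)
        (fun x hx => by
          obtain ⟨y, hy, rfl⟩ := Finset.mem_image.1 hx
          obtain ⟨k, hk, hneg⟩ := hN y (Finset.mem_of_mem_erase hy)
          cases k with
          | zero => exact absurd (hS y (Finset.mem_of_mem_erase hy)).2 hneg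
          | succ k => exact ⟨k, Nat.le_of_succ_le_succ hk, hneg⟩)
      have hmap : ∀ x, x ∈ L.map σ ↔ x ∈ S.erase (simpleRoot a) := fun x => by
        rw [List.mem_map]
        constructor
        · rintro ⟨y, hy, rfl⟩
          obtain ⟨z, hz, rfl⟩ := Finset.mem_image.1 ((hLm y).1 hy)
          rwa [hinv]
        · exact fun hx => ⟨σ x, (hLm _).2 (Finset.mem_image_of_mem σ hx), hinv x⟩
      have hnodup : (L.map σ).Nodup := hLn.map (Function.LeftInverse.injective hinv)
      have hpair : (L.map σ).Pairwise fun x y =>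
          0 ≤ orderForm C d (a :: t) x y ∧ orderForm C d (a :: t) y x ≤ 0 := by
        rw [List.pairwise_map]
        refine hLp.imp fun {x y} h => ?_
        rwa [← orderForm_rotate (hC.diag a) hC.symm hl hmem, ← hσ, hinv, hinv,
          ← orderForm_rotate (hC.diag a) hC.symm hl hmem, ← hσ, hinv, hinv]
      by_cases haS : simpleRoot a ∈ S
      · refine ⟨simpleRoot a :: L.map σ, List.nodup_cons.2 ⟨fun h => ?_, hnodup⟩, fun x => ?_,
          List.pairwise_cons.2 ⟨fun y hy => ?_, hpair⟩⟩
        · simpa using (hmap _).1 h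
        · rw [List.mem_cons, hmap, Finset.mem_erase]
          by_cases hx : x = simpleRoot a
          · simp [hx, haS]
          · simp [hx]
        · obtain ⟨hne, hyS⟩ := Finset.mem_erase.1 ((hmap y).1 hy)
          obtain ⟨hyr, hy0⟩ := hS y hyS
          rw [orderForm_simpleRoot_left C d (List.nodup_cons.1 hl).1,
            orderForm_simpleRoot_right d (hC.diag a) hl hmem, neg_nonpos]
          exact ⟨mul_nonneg (hC.pos a).le (hy0 a),
            mul_nonneg (hC.pos a).le (hyr.reflection_nonneg hC hy0 hne a)⟩
      · refine ⟨L.map σ, hnodup, fun x => ?_, hpair⟩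
        rw [hmap, Finset.erase_eq_of_notMem haS]

end Enumeration

/-! ### Directed enumerations and partitions -/

theorem mainTheorem6 {I : Type*} [Fintype I] [LinearOrder I] (C : Matrix I I ℤ) (d : I → ℤ)
    (hC : IsFiniteTypeCartan C d) :
    (∃ (ν : ℕ) (α : Fin ν → (I → ℤ)),
      Function.Injective α ∧ Set.range α = positiveRoots C ∧
      (∀ k l, k ≤ l → 0 ≤ eulerForm C d (α k) (α l)) ∧
      (∀ k l, l < k → eulerForm C d (α k) (α l) ≤ 0)) ∧
    (∃ (k : ℕ) (P : Fin k → Set (I → ℤ)), IsDirectedPartition C d P) := by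
  have hfin : (positiveRoots C).Finite :=
    (finite_rootVectors hC).subset fun x hx => hx.1.isRootVector hC
  set S := hfin.toFinset
  have hS : ∀ x ∈ S, IsRootVector C d x ∧ ∀ i, 0 ≤ x i := fun x hx => by
    have hx' := hfin.mem_toFinset.1 hx
    exact ⟨hx'.1.isRootVector hC, hx'.2⟩
  set l := Finset.univ.sort (α := I) (· ≥ ·)
  have hmem : ∀ i, i ∈ l := fun i => (Finset.mem_sort _).2 (Finset.mem_univ i)
  have hnodup : l.Nodup := Finset.sort_nodup _ _
  have hsort : l.Pairwise (· > ·) :=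
    ((Finset.pairwise_sort _ _).and hnodup).imp fun h => lt_of_le_of_ne h.1 h.2.symm
  choose! f hf using fun x hx => (hS x hx).1.exists_trajectory_neg hC hnodup hmem
  obtain ⟨L, hLn, hLm, hLp⟩ := exists_directed_list hC (S.sup f) l hnodup hmem S hS
    fun x hx => ⟨f x, Finset.le_sup hx, hf x hx⟩
  simp only [orderForm_eq_eulerForm hC.symm hsort hmem] at hLp
  rw [List.pairwise_iff_get] at hLp
  have hinj : Function.Injective L.get := List.nodup_iff_injective_get.1 hLn
  have hrange : Set.range L.get = positiveRoots C := by
    ext x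
    rw [Set.range_list_get, Set.mem_ofPred_eq, hLm, hfin.mem_toFinset]
  have hself : ∀ k, 0 ≤ eulerForm C d (L.get k) (L.get k) := fun k =>
    ((hS _ ((hLm _).1 (L.get_mem k))).1.norm_pos hC).le
  refine ⟨⟨L.length, L.get, hinj, hrange, fun k m hkm => ?_, fun k m hmk => (hLp m k hmk).2⟩, ?_⟩
  · rcases hkm.lt_or_eq with h | rfl
    · exact (hLp k m h).1
    · exact hself k
  -- The parts of the partition are the singletons of the enumeration.
  · refine ⟨L.length, fun k => {L.get k}, fun k => Set.singleton_nonempty _, fun k m hkm => ?_,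
      ?_, ?_, ?_⟩
    · exact Set.disjoint_singleton.2 (hinj.ne hkm)
    · rw [← hrange]
      exact Set.iUnion_singleton_eq_range _
    · rintro k x rfl y rfl
      exact hself k
    · rintro k m hkm x rfl y rfl
      exact hLp k m hkm
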